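/- \textbf{Setting.} Let $f(w)=\frac1n\sum_{i=1}^n l(w,x_i)$, $w\in\mathbb R^d$, $d\ge1$, where $l(\cdot,x)$ is twice continuously differentiable with $G$-Lipschitz gradient and $M$-Lipschitz Hessian ($G,M>0$), $0\le l\le B$, $\|\nabla_w l\|\le B_g$, $\|\nabla_w^2 l\|\le B_H$, and let $\underline f\le f$ be a constant. Let $\epsilon_g,\epsilon_H>0$; let $c,c_1,c_2>0$ with $c_1<\frac12$, $c_2+c<\frac13$; let $C>0$, $c_f,\zeta,\eta\in(0,1)$, $\varepsilon,\delta\in(0,1)$; let $1\le m\le n$ be the mini-batch size and $s=m/n$. The mini-batch short step algorithm, started at $w_0$, uses $$\mathrm{MIN\_DEC}=\min\Bigl(\tfrac{1-2c_1}{2G}\epsilon_g^2,\;2(\tfrac13-c_2-c)\tfrac{\epsilon_H^3}{M^2}\Bigr),\qquad T=\Bigl\lceil\frac{f(w_0)+|z|-\underline f}{\mathrm{MIN\_DEC}}\Bigr\rceil,$$ where $z\sim\mathcal N(0,\Delta_f^2\sigma_f^2)$, $\Delta_f=B/m$, and, with $\varepsilon_f=c_f\varepsilon$, $\delta_f=c_f\delta$,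 $$\sigma_f=\frac{\sqrt{2\ln(1.25/\delta_f)}}{\varepsilon_f},\quad \varepsilon_0=\frac{\varepsilon-\varepsilon_f}{8s\sqrt{2T\ln(2/(\delta-\delta_f))}},\quad \delta_0=\frac{\delta-\delta_f}{4sT},\quad \sigma_g=\sigma_H=\frac{\sqrt{2\ln(1.25/\delta_0)}}{\varepsilon_0}.$$ Its required number of samples is $$n_{\min}=\max\Bigl(\tfrac{2\sqrt{2d}\,B_g\sigma_g\log\frac T\zeta}{\min(c_1\epsilon_g,\frac{c_2}{M}\epsilon_H^2)},\ \tfrac{2C\sqrt d\,B_H\sigma_H\log\frac T\zeta}{c\,\epsilon_H},\ \tfrac{64B_g^2}{s}\bigl(\log\tfrac{2dT}{\eta}+\tfrac14\bigr)\max\bigl(\tfrac{1}{c_1^2\epsilon_g^2},\tfrac{M^2}{c_2^2\epsilon_H^4}\bigr),\ \tfrac{32B_H^2}{s\,c^2\epsilon_H^2}\log\tfrac{2dT}{\eta}\Bigr).$$ \textbf{Theorem.} Fix $G,M,B,B_g,B_H,\underline f,c,c_1,c_2,C,c_f,\zeta,\eta$, a lower bound $s_{\min}\in(0,1]$ on $s$,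 an upper bound on $\epsilon_g,\epsilon_H$ and an upper bound $\delta_{\max}<1$ on $\delta$. Then, uniformly over all $d$, $n$, $m$, losses, datasets, $w_0$, $\varepsilon$, $\delta$, $\epsilon_g$, $\epsilon_H$ within these bounds, $$n_{\min}=\tilde O\Bigl(\frac{\sqrt d\,\ln(1/\delta)}{\varepsilon}\max\bigl(\epsilon_g^{-2},\epsilon_g^{-1}\epsilon_H^{-2},\epsilon_H^{-4}\bigr)\Bigr).$$ When $(\epsilon_g,\epsilon_H)=(\alpha,\sqrt{M\alpha})$ this becomes $n_{\min}=\tilde O\bigl(\frac{\sqrt d\ln(1/\delta)}{\varepsilon\alpha^2}\bigr)$, and in particular $n_{\min}=\tilde O\bigl(\frac{d\ln(1/\delta)}{\varepsilon\alpha^2}\bigr)$. Here $n_{\min}=\tilde O(X)$ means the following two things, since $n_{\min}$ depends on the random $z$. (1) For every $Z$ there are $K>0$, $k\in\mathbb N$ depending only on the fixed quantities and $Z$ such that $n_{\min}\le K X\log^k(2+X)$ for every realization with $|z|\le Z$. (2) For every $\beta\in(0,1)$ there are $K>0$, $k\in\mathbb N$ depending only on the fixed quantities and $\beta$ such that, whenever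 $n\ge KX\log^k(2+X)$, one has $n_{\min}\le KX\log^k(2+X)$ with probability at least $1-\beta$ over $z$. -/

import Mathlib

universe u

namespace DPMiniBatch

noncomputable section

/-- The parameters that stay fixed in the asymptotic analysis. -/
structure Consts where
  /-- Lipschitz constant of the gradient of the loss -/
  G : ℝ
  /-- Lipschitz constant of the Hessian of the loss -/
  M : ℝ
  /-- bound on the loss values -/
  B : ℝ
  /-- bound on the loss gradients -/
  Bg : ℝ
  /-- bound on the loss Hessians -/
  BH : ℝ
  /-- known lower bound of the empirical risk -/
  fLow : ℝ
  /-- noise-accuracy constants -/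
  c : ℝ
  c₁ : ℝ
  c₂ : ℝ
  /-- constant of the random-matrix tail bound -/
  C : ℝ
  /-- fraction of the privacy budget spent on estimating the iteration bound -/
  cf : ℝ
  /-- failure-probability parameters (Gaussian noise, subsampling) -/
  ζ : ℝ
  η : ℝ
  /-- lower bound on the sampling fraction -/
  sMin : ℝ

/-- The admissible values of the fixed parameters. -/
structure Consts.Valid (P : Consts) : Prop where
  G_pos : 0 < P.G
  M_pos : 0 < P.M
  c_pos : 0 < P.c
  c₁_pos : 0 < P.c₁
  c₂_pos : 0 < P.c₂
  c₁_lt : P.c₁ < 1 / 2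
  c₂_add_c_lt : P.c₂ + P.c < 1 / 3
  C_pos : 0 < P.C
  cf_mem : P.cf ∈ Set.Ioo (0 : ℝ) 1
  ζ_mem : P.ζ ∈ Set.Ioo (0 : ℝ) 1
  η_mem : P.η ∈ Set.Ioo (0 : ℝ) 1
  sMin_mem : P.sMin ∈ Set.Ioc (0 : ℝ) 1

/-- The gradient in `w` of the loss `l w x`. -/
def lossGrad {d : ℕ} {X : Type u} (l : EuclideanSpace ℝ (Fin d) → X → ℝ)
    (w : EuclideanSpace ℝ (Fin d)) (x : X) : EuclideanSpace ℝ (Fin d) :=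
  gradient (fun v => l v x) w

/-- The Hessian in `w` of the loss `l w x`, as an operator (its norm is the matrix 2-norm). -/
def lossHess {d : ℕ} {X : Type u} (l : EuclideanSpace ℝ (Fin d) → X → ℝ)
    (w : EuclideanSpace ℝ (Fin d)) (x : X) :
    EuclideanSpace ℝ (Fin d) →L[ℝ] EuclideanSpace ℝ (Fin d) :=
  fderiv ℝ (fun v => lossGrad l v x) w

/-- Smoothness and boundedness of the loss. -/
structure LossAssumptions (P : Consts) {d : ℕ} {X : Type u}
    (l : EuclideanSpace ℝ (Fin d) → X → ℝ) : Prop where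
  contDiff : ∀ x, ContDiff ℝ 2 (fun w => l w x)
  grad_lipschitz : ∀ x w₁ w₂, ‖lossGrad l w₁ x - lossGrad l w₂ x‖ ≤ P.G * ‖w₁ - w₂‖
  hess_lipschitz : ∀ x w₁ w₂, ‖lossHess l w₁ x - lossHess l w₂ x‖ ≤ P.M * ‖w₁ - w₂‖
  nonneg : ∀ w x, 0 ≤ l w x
  le_B : ∀ w x, l w x ≤ P.B
  grad_le : ∀ w x, ‖lossGrad l w x‖ ≤ P.Bg
  hess_le : ∀ w x, ‖lossHess l w x‖ ≤ P.BH

/-- The empirical risk of `w` on the dataset `D`. -/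
def empiricalRisk {d n : ℕ} {X : Type u} (l : EuclideanSpace ℝ (Fin d) → X → ℝ)
    (D : Fin n → X) (w : EuclideanSpace ℝ (Fin d)) : ℝ :=
  (1 / (n : ℝ)) * ∑ i, l w (D i)

/-- One input of the mini-batch short step algorithm: an ERM problem with its starting point,
a mini-batch size, a privacy budget and tolerances. -/
structure Run (P : Consts) : Type (u + 1) where
  /-- dimension -/
  d : ℕ
  /-- number of samples -/
  n : ℕ
  /-- mini-batch size -/
  m : ℕ
  /-- space of data points -/
  X : Type u
  loss : EuclideanSpace ℝ (Fin d) → X → ℝ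
  data : Fin n → X
  /-- initial point -/
  w₀ : EuclideanSpace ℝ (Fin d)
  /-- privacy parameters -/
  ε : ℝ
  δ : ℝ
  /-- gradient tolerance -/
  εg : ℝ
  /-- Hessian tolerance -/
  εH : ℝ
  d_pos : 0 < d
  m_pos : 0 < m
  m_le : m ≤ n
  sMin_le : P.sMin ≤ (m : ℝ) / n
  lossAssumptions : LossAssumptions P loss
  fLow_le : ∀ w, P.fLow ≤ empiricalRisk loss data w
  ε_mem : ε ∈ Set.Ioo (0 : ℝ) 1
  δ_mem : δ ∈ Set.Ioo (0 : ℝ) 1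
  εg_pos : 0 < εg
  εH_pos : 0 < εH

namespace Run

variable {P : Consts} (R : Run.{u} P)

/-- Sampling fraction `s = m / n`. -/
def s : ℝ := (R.m : ℝ) / R.n

/-- Part of the privacy budget spent on the function value. -/
def εf : ℝ := P.cf * R.ε

def δf : ℝ := P.cf * R.δ

/-- Noise multiplier of the function value. -/
def σf : ℝ := √(2 * Real.log (1.25 / R.δf)) / R.εf

/-- Sensitivity of the function value; in the mini-batch algorithm the mini-batch size replaces
the number of samples. -/
def Δf : ℝ := P.B / R.m

/-- Law `N(0, Δf² σf²)` of the noise `z` added to the initial function value. -/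
def lawZ : MeasureTheory.Measure ℝ :=
  ProbabilityTheory.gaussianReal 0 (Real.toNNReal (R.Δf ^ 2 * R.σf ^ 2))

/-- Guaranteed decrease per iteration of the short step algorithm. -/
def minDec : ℝ :=
  min ((1 - 2 * P.c₁) / (2 * P.G) * R.εg ^ 2)
    (2 * (1 / 3 - P.c₂ - P.c) * (R.εH ^ 3 / P.M ^ 2))

/-- The iteration bound computed by the algorithm from the noise value `z`. -/
def T (z : ℝ) : ℕ :=
  ⌈(empiricalRisk R.loss R.data R.w₀ + |z| - P.fLow) / R.minDec⌉₊

/-- Privacy parameters of one gradient or Hessian evaluation. -/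
def ε₀ (z : ℝ) : ℝ :=
  (R.ε - R.εf) / (8 * R.s * √(2 * (R.T z : ℝ) * Real.log (2 / (R.δ - R.δf))))

def δ₀ (z : ℝ) : ℝ := (R.δ - R.δf) / (4 * R.s * (R.T z : ℝ))

/-- Noise multiplier of the gradient. -/
def σg (z : ℝ) : ℝ := √(2 * Real.log (1.25 / R.δ₀ z)) / R.ε₀ z

/-- Noise multiplier of the Hessian. -/
def σH (z : ℝ) : ℝ := R.σg z

/-- The number of samples required by the mini-batch short step algorithm, when the noise on the
initial function value is `z`. -/
def nMin (z : ℝ) : ℝ :=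
  max
    (max
      (2 * √(2 * (R.d : ℝ)) * P.Bg * R.σg z * Real.log ((R.T z : ℝ) / P.ζ) /
        min (P.c₁ * R.εg) (P.c₂ / P.M * R.εH ^ 2))
      (2 * P.C * √(R.d : ℝ) * P.BH * R.σH z * Real.log ((R.T z : ℝ) / P.ζ) / (P.c * R.εH)))
    (max
      (R.s⁻¹ * 64 * P.Bg ^ 2 * (Real.log (2 * (R.d : ℝ) * (R.T z : ℝ) / P.η) + 1 / 4) *
        max ((P.c₁ ^ 2)⁻¹ * (R.εg ^ 2)⁻¹) (P.M ^ 2 / P.c₂ ^ 2 * (R.εH ^ 4)⁻¹))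
      (R.s⁻¹ * 32 * P.BH ^ 2 * Real.log (2 * (R.d : ℝ) * (R.T z : ℝ) / P.η) *
        (P.c ^ 2)⁻¹ * (R.εH ^ 2)⁻¹))

end Run

/-- The expression `K · x · log(2 + x)^k` behind `Õ(x)`. -/
def softBound (K : ℝ) (k : ℕ) (x : ℝ) : ℝ := K * x * Real.log (2 + x) ^ k

/-- `nMin = Õ(g)` uniformly over the runs in `S`. `nMin` is random through the noise `z`, so this is
stated in two ways: for every realization of `z`, with hidden constants that depend only on a bound
on `|z|` (and on `P` and `S`); and with high probability over `z ~ N(0, Δf² σf²)`, whose variance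
depends on the number of samples, as soon as that number is itself of the claimed order. -/
def NMinIsSoftO {P : Consts} (S : Set (Run.{u} P)) (g : Run.{u} P → ℝ) : Prop :=
  (∀ Z : ℝ, ∃ K : ℝ, 0 < K ∧ ∃ k : ℕ, ∀ R ∈ S, ∀ z : ℝ, |z| ≤ Z →
    R.nMin z ≤ softBound K k (g R)) ∧
  (∀ β ∈ Set.Ioo (0 : ℝ) 1, ∃ K : ℝ, 0 < K ∧ ∃ k : ℕ, ∀ R ∈ S,
    softBound K k (g R) ≤ (R.n : ℝ) →
      1 - β ≤ R.lawZ.real {z : ℝ | R.nMin z ≤ softBound K k (g R)})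

end

end DPMiniBatch

namespace DPMiniBatch

/-! Everything is measured by `invTol`, written μ, the larger of 1/εg and 1/εH². Its square is
exactly the maximum in the claimed rate. Since εH ≤ tol, the weaker powers 1/εH, 1/εH², 1/εH³ are
dominated by tol·μ, tol²·μ², tol·μ², so 1/MIN_DEC, and with it T, is O(μ²) (`exists_T_le`). Noise
grows like √T: the two square roots in σg each contribute √log(1/δ), so σg is μ·log(1/δ)/ε up to
logarithms (`exists_σg_le`). The noise terms of n_min multiply √d·σg by at most a constant times μ
and give the rate; the subsampling terms are μ²/s up to logarithms, and s ≥ sMin. The logarithms are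
harmless because the rate x dominates both √d and μ² up to constants: d and T are then polynomial in
x, and their logarithms are O(log(2+x)). This needs log(1/δ) bounded below, which is what δMax < 1
provides. For random z, the standard deviation of z is O(x/m). Since m ≥ sMin·n, a large enough n
makes it at most 1, and Chebyshev's inequality reduces the claim to |z| ≤ 1/√β
(`nMinIsSoftO_of_inRange`). The predicate `InRange` lets one argument serve all three rates. -/

/-- The 2 in log(2+x) keeps it at least log 2, so the constant log K can be absorbed. The value u =
0 is admitted because T may be 0. -/
theorem log_le_mul_log_two_add {K : ℝ} (hK : 1 ≤ K) (j : ℕ) {u x : ℝ} (hx : 0 ≤ x) (hu : 0 ≤ u)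
    (h : u ≤ K * (2 + x) ^ j) :
    Real.log u ≤ (Real.log K / Real.log 2 + j) * Real.log (2 + x) := by
  have h2 : 0 < Real.log 2 := Real.log_pos (by norm_num)
  have hl : Real.log 2 ≤ Real.log (2 + x) := Real.log_le_log (by norm_num) (by linarith)
  have hlK : 0 ≤ Real.log K := Real.log_nonneg hK
  rcases hu.eq_or_lt with rfl | hu
  · rw [Real.log_zero]
    exact mul_nonneg (by positivity) (h2.le.trans hl)
  have h1 := Real.log_le_log hu h
  rw [Real.log_mul (by positivity) (by positivity), Real.log_pow] at h1
  have h3 : Real.log K ≤ Real.log K / Real.log 2 * Real.log (2 + x) := by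
    rw [div_mul_eq_mul_div, le_div_iff₀ h2]
    exact mul_le_mul_of_nonneg_left hl hlK
  linarith

theorem inv_min_le_add {p q : ℝ} (hp : 0 < p) (hq : 0 < q) : (min p q)⁻¹ ≤ p⁻¹ + q⁻¹ := by
  rcases min_choice p q with h | h <;> rw [h]
  · linarith [inv_pos.2 hq]
  · linarith [inv_pos.2 hp]

/-! ### Bounds on the data of a run and powers of the tolerances -/

namespace Run

variable {P : Consts} (R : Run.{u} P)

theorem n_pos : 0 < R.n := R.m_pos.trans_le R.m_le

theorem s_pos : 0 < R.s :=
  div_pos (Nat.cast_pos.2 R.m_pos) (Nat.cast_pos.2 R.n_pos)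

theorem s_le_one : R.s ≤ 1 :=
  div_le_one_of_le₀ (Nat.cast_le.2 R.m_le) (Nat.cast_nonneg _)

theorem B_nonneg (R : Run.{u} P) : 0 ≤ P.B :=
  (R.lossAssumptions.nonneg R.w₀ (R.data ⟨0, R.n_pos⟩)).trans (R.lossAssumptions.le_B _ _)

theorem Bg_nonneg (R : Run.{u} P) : 0 ≤ P.Bg :=
  (norm_nonneg _).trans (R.lossAssumptions.grad_le R.w₀ (R.data ⟨0, R.n_pos⟩))

theorem BH_nonneg (R : Run.{u} P) : 0 ≤ P.BH :=
  (norm_nonneg _).trans (R.lossAssumptions.hess_le R.w₀ (R.data ⟨0, R.n_pos⟩))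

theorem empiricalRisk_le : empiricalRisk R.loss R.data R.w₀ ≤ P.B := by
  have hn : (0 : ℝ) < R.n := Nat.cast_pos.2 R.n_pos
  have h : ∑ i, R.loss R.w₀ (R.data i) ≤ R.n * P.B := by
    simpa using Finset.sum_le_card_nsmul Finset.univ (fun i => R.loss R.w₀ (R.data i)) P.B
      fun i _ => R.lossAssumptions.le_B _ _
  rw [empiricalRisk, one_div, inv_mul_le_iff₀ hn]
  exact h

/-- The inverse of the accuracy to which gradients have to be known, up to constants. -/
noncomputable def invTol : ℝ := max R.εg⁻¹ (R.εH ^ 2)⁻¹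

theorem inv_εg_le : R.εg⁻¹ ≤ R.invTol := le_max_left _ _

theorem inv_sq_εH_le : (R.εH ^ 2)⁻¹ ≤ R.invTol := le_max_right _ _

theorem invTol_pos : 0 < R.invTol := (inv_pos.2 R.εg_pos).trans_le R.inv_εg_le

theorem inv_sq_εg_le : (R.εg ^ 2)⁻¹ ≤ R.invTol ^ 2 := by
  rw [← inv_pow]
  exact pow_le_pow_left₀ (inv_pos.2 R.εg_pos).le R.inv_εg_le 2

theorem inv_pow_four_εH_le : (R.εH ^ 4)⁻¹ ≤ R.invTol ^ 2 := by
  have h := pow_le_pow_left₀ (inv_pos.2 (pow_pos R.εH_pos 2)).le R.inv_sq_εH_le 2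
  rwa [inv_pow, ← pow_mul] at h

/-- The mixed entry is the product of the two numbers whose maximum is μ, so it never exceeds μ². -/
theorem invTol_sq : R.invTol ^ 2 =
    max (max (R.εg ^ 2)⁻¹ (R.εg⁻¹ * (R.εH ^ 2)⁻¹)) (R.εH ^ 4)⁻¹ := by
  have ha := inv_pos.2 R.εg_pos
  have hb := inv_pos.2 (pow_pos R.εH_pos 2)
  refine le_antisymm ?_ (max_le (max_le R.inv_sq_εg_le ?_) R.inv_pow_four_εH_le)
  · rcases max_choice R.εg⁻¹ (R.εH ^ 2)⁻¹ with h | h <;> rw [invTol, h, inv_pow]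
    · exact (le_max_left _ _).trans (le_max_left _ _)
    · rw [← pow_mul]
      exact le_max_right _ _
  · rw [sq R.invTol]
    exact mul_le_mul R.inv_εg_le R.inv_sq_εH_le hb.le R.invTol_pos.le

/-- The leading factor of the sample complexity. -/
noncomputable def rate : ℝ := √(R.d : ℝ) * Real.log (1 / R.δ) / R.ε * R.invTol ^ 2

/-- The tolerances are at most `tol`, `log (1 / δ)` is at least `L₀`, and the leading factor of the
sample complexity is at most `A * x`. -/
structure InRange (tol L₀ A x : ℝ) : Prop where
  εg_le : R.εg ≤ tol
  εH_le : R.εH ≤ tol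
  le_log : L₀ ≤ Real.log (1 / R.δ)
  rate_le : R.rate ≤ A * x

theorem one_le_sqrt_d : 1 ≤ √(R.d : ℝ) :=
  Real.one_le_sqrt.2 (Nat.one_le_cast.2 R.d_pos)

theorem log_pos : 0 < Real.log (1 / R.δ) :=
  Real.log_pos ((one_lt_div R.δ_mem.1).2 R.δ_mem.2)

variable {R}

namespace InRange

variable {tol L₀ A x : ℝ}

theorem tol_pos (h : R.InRange tol L₀ A x) : 0 < tol := R.εg_pos.trans_le h.εg_le

theorem one_le (h : R.InRange tol L₀ A x) : 1 ≤ tol ^ 2 * R.invTol ^ 2 := by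
  rw [← mul_pow]
  refine one_le_pow₀ ?_
  calc 1 = R.εg * R.εg⁻¹ := (mul_inv_cancel₀ R.εg_pos.ne').symm
    _ ≤ tol * R.invTol :=
      mul_le_mul h.εg_le R.inv_εg_le (inv_pos.2 R.εg_pos).le h.tol_pos.le

theorem inv_εH_le (h : R.InRange tol L₀ A x) : R.εH⁻¹ ≤ tol * R.invTol := by
  have := R.εH_pos
  calc R.εH⁻¹ = R.εH * (R.εH ^ 2)⁻¹ := by field_simp
    _ ≤ tol * R.invTol :=
      mul_le_mul h.εH_le R.inv_sq_εH_le (by positivity) h.tol_pos.le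

theorem inv_sq_εH_le_mul_sq (h : R.InRange tol L₀ A x) :
    (R.εH ^ 2)⁻¹ ≤ tol ^ 2 * R.invTol ^ 2 := by
  rw [← inv_pow, ← mul_pow]
  exact pow_le_pow_left₀ (inv_pos.2 R.εH_pos).le h.inv_εH_le 2

theorem inv_cube_εH_le (h : R.InRange tol L₀ A x) : (R.εH ^ 3)⁻¹ ≤ tol * R.invTol ^ 2 := by
  have := R.εH_pos
  calc (R.εH ^ 3)⁻¹ = R.εH * (R.εH ^ 4)⁻¹ := by field_simp
    _ ≤ tol * R.invTol ^ 2 :=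
      mul_le_mul h.εH_le R.inv_pow_four_εH_le (by positivity) h.tol_pos.le

/-- Strips √d ≥ 1 and μ² ≥ tol⁻² from the rate; this controls the standard deviation of z. -/
theorem log_div_mul_le (h : R.InRange tol L₀ A x) :
    Real.log (1 / R.δ) / R.ε ≤ A * tol ^ 2 * x := by
  have hL' := R.log_pos
  have hε := R.ε_mem.1
  calc Real.log (1 / R.δ) / R.ε
      ≤ √(R.d : ℝ) * (Real.log (1 / R.δ) / R.ε) :=
        le_mul_of_one_le_left (by positivity) R.one_le_sqrt_d
    _ ≤ √(R.d : ℝ) * (Real.log (1 / R.δ) / R.ε) * (tol ^ 2 * R.invTol ^ 2) :=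
        le_mul_of_one_le_right (by positivity) h.one_le
    _ = tol ^ 2 * R.rate := by rw [rate]; ring
    _ ≤ tol ^ 2 * (A * x) := mul_le_mul_of_nonneg_left h.rate_le (sq_nonneg _)
    _ = A * tol ^ 2 * x := by ring

/-- Strips the privacy factor from the rate: ε < 1 gives log(1/δ)/ε ≥ L₀. -/
theorem sqrt_mul_invTol_sq_le (h : R.InRange tol L₀ A x) (hL : 0 < L₀) :
    √(R.d : ℝ) * R.invTol ^ 2 ≤ A / L₀ * x := by
  have hε := R.ε_mem.1
  have h1 : L₀ ≤ Real.log (1 / R.δ) / R.ε :=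
    h.le_log.trans (le_div_self R.log_pos.le hε R.ε_mem.2.le)
  rw [div_mul_eq_mul_div, le_div_iff₀ hL]
  calc √(R.d : ℝ) * R.invTol ^ 2 * L₀
      ≤ √(R.d : ℝ) * R.invTol ^ 2 * (Real.log (1 / R.δ) / R.ε) :=
        mul_le_mul_of_nonneg_left h1 (by positivity)
    _ = R.rate := by rw [rate]; ring
    _ ≤ A * x := h.rate_le

theorem invTol_sq_le (h : R.InRange tol L₀ A x) (hL : 0 < L₀) :
    R.invTol ^ 2 ≤ A / L₀ * x :=
  (le_mul_of_one_le_left (by positivity) R.one_le_sqrt_d).trans (h.sqrt_mul_invTol_sq_le hL)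

theorem d_le (h : R.InRange tol L₀ A x) (hL : 0 < L₀) :
    (R.d : ℝ) ≤ (tol ^ 2 * (A / L₀)) ^ 2 * x ^ 2 := by
  have h1 : √(R.d : ℝ) ≤ tol ^ 2 * (A / L₀) * x :=
    calc √(R.d : ℝ) ≤ √(R.d : ℝ) * (tol ^ 2 * R.invTol ^ 2) :=
          le_mul_of_one_le_right (by positivity) h.one_le
      _ = tol ^ 2 * (√(R.d : ℝ) * R.invTol ^ 2) := by ring
      _ ≤ tol ^ 2 * (A / L₀ * x) :=
          mul_le_mul_of_nonneg_left (h.sqrt_mul_invTol_sq_le hL) (sq_nonneg _)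
      _ = _ := by ring
  have h2 := pow_le_pow_left₀ (Real.sqrt_nonneg _) h1 2
  rwa [Real.sq_sqrt (Nat.cast_nonneg _), mul_pow] at h2

theorem x_pos (h : R.InRange tol L₀ A x) (hL : 0 < L₀) (hA : 0 < A) : 0 < x := by
  have h1 := (pow_pos R.invTol_pos 2).trans_le (h.invTol_sq_le hL)
  exact pos_of_mul_pos_right h1 (by positivity)

end InRange

/-! ### Iteration count and logarithmic factors -/

/-- The number of iterations grows at most like the square of `invTol`. -/
theorem exists_T_le (hP : P.Valid) (tol Z : ℝ) : ∃ K : ℝ, 1 ≤ K ∧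
    ∀ (R : Run.{u} P) (L₀ A x z : ℝ), R.InRange tol L₀ A x → |z| ≤ Z →
      (R.T z : ℝ) ≤ K * R.invTol ^ 2 := by
  set a₁ : ℝ := (1 - 2 * P.c₁) / (2 * P.G) with ha₁
  set a₂ : ℝ := 2 * (1 / 3 - P.c₂ - P.c) / P.M ^ 2 with ha₂
  have h₁ : 0 < a₁ := div_pos (by linarith [hP.c₁_lt]) (by linarith [hP.G_pos])
  have h₂ : 0 < a₂ := div_pos (by linarith [hP.c₂_add_c_lt]) (pow_pos hP.M_pos 2)
  set D : ℝ := |P.B| + |Z| + |P.fLow| with hD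
  have hD0 : 0 ≤ D := by positivity
  -- D bounds the numerator of T. The summand tol² pays for the +1 of the ceiling, because 1 ≤
  -- tol²·μ².
  refine ⟨max 1 (D * (a₁⁻¹ + a₂⁻¹ * tol) + tol ^ 2), le_max_left _ _, ?_⟩
  intro R L₀ A x z h hz
  have hg : 0 < a₁ * R.εg ^ 2 := mul_pos h₁ (pow_pos R.εg_pos 2)
  have hH : 0 < a₂ * R.εH ^ 3 := mul_pos h₂ (pow_pos R.εH_pos 3)
  have hmin : R.minDec = min (a₁ * R.εg ^ 2) (a₂ * R.εH ^ 3) := by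
    rw [minDec, ha₁, ha₂]
    congr 1
    ring
  have hinv : R.minDec⁻¹ ≤ (a₁⁻¹ + a₂⁻¹ * tol) * R.invTol ^ 2 := by
    rw [hmin]
    refine (inv_min_le_add hg hH).trans ?_
    rw [mul_inv, mul_inv, add_mul, mul_assoc a₂⁻¹]
    exact add_le_add (mul_le_mul_of_nonneg_left R.inv_sq_εg_le (inv_pos.2 h₁).le)
      (mul_le_mul_of_nonneg_left h.inv_cube_εH_le (inv_pos.2 h₂).le)
  have hpos : 0 < R.minDec := by
    rw [hmin]
    exact lt_min hg hH
  have hnum : empiricalRisk R.loss R.data R.w₀ + |z| - P.fLow ≤ D := by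
    have := R.empiricalRisk_le
    have := le_abs_self P.B
    have := le_abs_self Z
    have := neg_abs_le P.fLow
    linarith
  have hle : R.T z ≤ ⌈D / R.minDec⌉₊ :=
    Nat.ceil_le_ceil (div_le_div_of_nonneg_right hnum hpos.le)
  have hlt := Nat.ceil_lt_add_one (div_nonneg hD0 hpos.le)
  have hcast : (R.T z : ℝ) ≤ (⌈D / R.minDec⌉₊ : ℝ) := Nat.cast_le.2 hle
  have hmul : D / R.minDec ≤ D * ((a₁⁻¹ + a₂⁻¹ * tol) * R.invTol ^ 2) := by
    rw [div_eq_mul_inv]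
    exact mul_le_mul_of_nonneg_left hinv hD0
  have hone := h.one_le
  calc (R.T z : ℝ) ≤ (D * (a₁⁻¹ + a₂⁻¹ * tol) + tol ^ 2) * R.invTol ^ 2 := by linarith
    _ ≤ _ := mul_le_mul_of_nonneg_right (le_max_right _ _) (sq_nonneg _)

/-- Logarithms of polynomial expressions in the number of iterations and the dimension are
dominated by `log (2 + x)`. -/
theorem exists_log_T_le (hP : P.Valid) {tol L₀ A : ℝ} (Z : ℝ) (hL : 0 < L₀) (hA : 0 < A)
    {a : ℝ} (ha : 0 < a) : ∃ K : ℝ, 0 < K ∧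
    ∀ (R : Run.{u} P) (x z : ℝ), R.InRange tol L₀ A x → |z| ≤ Z →
      Real.log (a * R.T z) ≤ K * Real.log (2 + x) ∧
      Real.log (a * R.d * R.T z) ≤ K * Real.log (2 + x) := by
  obtain ⟨K, hK, hT⟩ := exists_T_le.{u} hP tol Z
  set E := a * (K * (A / L₀)) with hE
  have hE0 : 0 < E := by positivity
  set F := (tol ^ 2 * (A / L₀)) ^ 2 with hF
  have hF0 : 0 ≤ F := sq_nonneg _
  set N := max 1 (E * (F + 1)) with hN
  have hN1 : 1 ≤ N := le_max_left _ _
  have hl2 : 0 < Real.log 2 := Real.log_pos (by norm_num)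
  have hlN : 0 ≤ Real.log N := Real.log_nonneg hN1
  -- The exponent 3 comes from d = O(x²) and T = O(x); the factor E·(F+1) covers both E and E·F.
  refine ⟨Real.log N / Real.log 2 + (3 : ℕ), by positivity, ?_⟩
  intro R x z h hz
  have hx := h.x_pos hL hA
  have hTx : a * R.T z ≤ E * x := by
    rw [hE, mul_assoc, mul_assoc]
    exact mul_le_mul_of_nonneg_left ((hT R _ _ _ z h hz).trans
      (mul_le_mul_of_nonneg_left (h.invTol_sq_le hL) (by positivity))) ha.le
  have hNE : E * (F + 1) ≤ N := le_max_right _ _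
  have hNx : E * (F + 1) * (2 + x) ^ 3 ≤ N * (2 + x) ^ 3 :=
    mul_le_mul_of_nonneg_right hNE (by positivity)
  refine ⟨log_le_mul_log_two_add hN1 3 hx.le (by positivity) (le_trans ?_ hNx),
    log_le_mul_log_two_add hN1 3 hx.le (by positivity) (le_trans ?_ hNx)⟩
  · refine hTx.trans (mul_le_mul (le_mul_of_one_le_right hE0.le (by linarith)) ?_ hx.le
      (by positivity))
    exact (by linarith : x ≤ 2 + x).trans (le_self_pow₀ (by linarith) (by norm_num))
  · calc a * R.d * R.T z = R.d * (a * R.T z) := by ring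
      _ ≤ F * x ^ 2 * (E * x) := mul_le_mul (h.d_le hL) hTx (by positivity) (by positivity)
      _ = E * F * x ^ 3 := by ring
      _ ≤ E * (F + 1) * (2 + x) ^ 3 := by
          gcongr <;> linarith

/-- A constant plus `log (1 / δ)` is of the order of `log (1 / δ)`. -/
theorem log_div_δ_le {a L₀ : ℝ} (ha : 0 < a) (hL : 0 < L₀) (R : Run.{u} P)
    (h : L₀ ≤ Real.log (1 / R.δ)) :
    Real.log (a / R.δ) ≤ (|Real.log a| / L₀ + 1) * Real.log (1 / R.δ) := by
  have hδ := R.δ_mem.1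
  have h1 : Real.log (a / R.δ) = Real.log a + Real.log (1 / R.δ) := by
    rw [← Real.log_mul ha.ne' (by positivity), mul_one_div]
  have h2 : |Real.log a| ≤ |Real.log a| / L₀ * Real.log (1 / R.δ) := by
    rw [div_mul_eq_mul_div, le_div_iff₀ hL]
    exact mul_le_mul_of_nonneg_left h (abs_nonneg _)
  linarith [le_abs_self (Real.log a)]

theorem σg_nonneg (hP : P.Valid) (R : Run.{u} P) (z : ℝ) : 0 ≤ R.σg z := by
  have h1 : 0 ≤ R.ε - R.εf := by
    rw [εf]
    nlinarith [R.ε_mem.1, hP.cf_mem.2]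
  have := R.s_pos
  exact div_nonneg (Real.sqrt_nonneg _) (div_nonneg h1 (by positivity))

/-! ### Noise multiplier of gradients and Hessians -/

/-- The noise multiplier of gradients and Hessians grows like the square root of the number of
iterations. -/
theorem exists_σg_le (hP : P.Valid) {tol L₀ A : ℝ} (Z : ℝ) (hL : 0 < L₀) (hA : 0 < A) :
    ∃ K : ℝ, 0 < K ∧ ∀ (R : Run.{u} P) (x z : ℝ), R.InRange tol L₀ A x → |z| ≤ Z →
      R.σg z ≤ K * Real.log (2 + x) * (Real.log (1 / R.δ) / R.ε) * R.invTol := by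
  have hcf : 0 < 1 - P.cf := by linarith [hP.cf_mem.2]
  have hl2 : 0 < Real.log 2 := Real.log_pos (by norm_num)
  obtain ⟨K₁, hK₁, hT⟩ := exists_T_le.{u} hP tol Z
  -- The 5 is 1.25 times the 4 in the denominator of δ₀.
  obtain ⟨K₂, hK₂, hlog⟩ := exists_log_T_le.{u} (tol := tol) hP Z hL hA
    (a := 5 / (1 - P.cf)) (by positivity)
  set Q₁ := K₂ / L₀ + 1 / Real.log 2 with hQ₁
  have hQ₁0 : 0 < Q₁ := by positivity
  set Q₂ := |Real.log (2 / (1 - P.cf))| / L₀ + 1 with hQ₂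
  have hQ₂0 : 0 < Q₂ := by positivity
  set Q := 4 * Q₁ * Q₂ * K₁ / Real.log 2 with hQ
  have hQ0 : 0 < Q := by positivity
  refine ⟨8 * √Q / (1 - P.cf), by positivity, ?_⟩
  intro R x z h hz
  have hx := h.x_pos hL hA
  have hl : Real.log 2 ≤ Real.log (2 + x) := Real.log_le_log (by norm_num) (by linarith)
  set l := Real.log (2 + x) with hl_def
  have hl0 : 0 < l := hl2.trans_le hl
  have hLδ := R.log_pos
  have hLle := h.le_log
  have hδ := R.δ_mem.1
  have hε := R.ε_mem.1
  have hs := R.s_pos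
  have hs1 := R.s_le_one
  have hμ := R.invTol_pos
  have hT' := hT R _ _ _ z h hz
  have hlog' := (hlog R x z h hz).1
  have hlogδ := log_div_δ_le (a := 2 / (1 - P.cf)) (by positivity) hL R h.le_log
  set L := Real.log (1 / R.δ) with hL_def
  have hδδ : R.δ - R.δf = (1 - P.cf) * R.δ := by rw [δf]; ring
  have hεε : R.ε - R.εf = (1 - P.cf) * R.ε := by rw [εf]; ring
  have e₂ : Real.log (2 / (R.δ - R.δf)) ≤ Q₂ * L := by
    rw [hδδ, ← div_div]
    exact hlogδ
  have e₁ : Real.log (1.25 / R.δ₀ z) ≤ Q₁ * l * L := by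
    -- For T = 0 the conventions 1.25/0 = 0 and log 0 = 0 make the left side 0.
    rcases Nat.eq_zero_or_pos (R.T z) with h0 | h0
    · simp only [δ₀, h0, Nat.cast_zero, mul_zero, div_zero, Real.log_zero]
      positivity
    have hTpos : (0 : ℝ) < R.T z := Nat.cast_pos.2 h0
    have e : 1.25 / R.δ₀ z = R.s * ((5 / (1 - P.cf) * R.T z) * (1 / R.δ)) := by
      rw [δ₀, hδδ]
      field_simp
      norm_num
    have e' : 1.25 / R.δ₀ z ≤ (5 / (1 - P.cf) * R.T z) * (1 / R.δ) := by
      rw [e]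
      exact mul_le_of_le_one_left (by positivity) hs1
    have e3 := Real.log_le_log (by rw [e]; positivity) e'
    rw [Real.log_mul (by positivity) (by positivity)] at e3
    have e4 : K₂ * l ≤ K₂ / L₀ * l * L := by
      have : K₂ * l * L₀ ≤ K₂ * l * L := mul_le_mul_of_nonneg_left hLle (by positivity)
      rw [div_mul_eq_mul_div, div_mul_eq_mul_div, le_div_iff₀ hL]
      exact this
    have e5 : L ≤ 1 / Real.log 2 * l * L := by
      refine le_mul_of_one_le_left hLδ.le ?_
      rw [one_div_mul_eq_div]
      exact (one_le_div hl2).2 hl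
    calc Real.log (1.25 / R.δ₀ z) ≤ K₂ / L₀ * l * L + 1 / Real.log 2 * l * L := by linarith
      _ = Q₁ * l * L := by rw [hQ₁]; ring
  have hsq : √(2 * Real.log (1.25 / R.δ₀ z)) *
      √(2 * (R.T z : ℝ) * Real.log (2 / (R.δ - R.δf))) ≤ √Q * (l * L * R.invTol) := by
    have p : 0 ≤ l * L * R.invTol := by positivity
    rw [← Real.sqrt_sq p, ← Real.sqrt_mul hQ0.le]
    refine (mul_le_mul (Real.sqrt_le_sqrt (mul_le_mul_of_nonneg_left e₁ (by norm_num)))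
      (Real.sqrt_le_sqrt ((mul_le_mul_of_nonneg_left e₂ (by positivity)).trans
        (mul_le_mul_of_nonneg_right (mul_le_mul_of_nonneg_left hT' (by norm_num))
          (by positivity)))) (Real.sqrt_nonneg _) (Real.sqrt_nonneg _)).trans ?_
    rw [← Real.sqrt_mul (by positivity)]
    refine Real.sqrt_le_sqrt ?_
    -- Only one factor l stands under the root; raising it to l² gives a perfect square, at the
    -- price of 1/log 2.
    have q : l ≤ l ^ 2 / Real.log 2 := by
      rw [le_div_iff₀ hl2, sq]
      exact mul_le_mul_of_nonneg_left hl hl0.le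
    calc 2 * (Q₁ * l * L) * (2 * (K₁ * R.invTol ^ 2) * (Q₂ * L))
        = 4 * Q₁ * Q₂ * K₁ * L ^ 2 * R.invTol ^ 2 * l := by ring
      _ ≤ 4 * Q₁ * Q₂ * K₁ * L ^ 2 * R.invTol ^ 2 * (l ^ 2 / Real.log 2) :=
          mul_le_mul_of_nonneg_left q (by positivity)
      _ = Q * (l * L * R.invTol) ^ 2 := by rw [hQ]; ring
  have hrhs : 0 ≤ √Q * (l * L * R.invTol) := by positivity
  calc R.σg z = 8 / ((1 - P.cf) * R.ε) * (R.s * (√(2 * Real.log (1.25 / R.δ₀ z)) *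
        √(2 * (R.T z : ℝ) * Real.log (2 / (R.δ - R.δf))))) := by
        rw [σg, ε₀, hεε, div_div_eq_mul_div]
        ring
    _ ≤ 8 / ((1 - P.cf) * R.ε) * (√Q * (l * L * R.invTol)) := by
        refine mul_le_mul_of_nonneg_left ?_ (by positivity)
        exact (mul_le_of_le_one_left (by positivity) hs1).trans hsq
    _ = 8 * √Q / (1 - P.cf) * l * (L / R.ε) * R.invTol := by
        field_simp


/-! ### The four terms of the sample size -/

/-- The slot r takes the inverse accuracy, rescaled to be at most μ, so that the gradient and the
Hessian noise terms are both instances. One logarithm comes from σg, one from log(T/ζ). -/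
theorem exists_sqrt_d_mul_σg_mul_log_mul_le (hP : P.Valid) {tol L₀ A : ℝ} (Z : ℝ) (hL : 0 < L₀)
    (hA : 0 < A) : ∃ K : ℝ, ∀ (R : Run.{u} P) (x z r : ℝ), R.InRange tol L₀ A x → |z| ≤ Z →
      0 ≤ r → r ≤ R.invTol →
      √(R.d : ℝ) * R.σg z * Real.log ((R.T z : ℝ) / P.ζ) * r ≤
        K * (x * Real.log (2 + x) ^ 2) := by
  obtain ⟨K₁, hK₁, hσ⟩ := exists_σg_le.{u} (tol := tol) hP Z hL hA
  obtain ⟨K₂, hK₂, hlog⟩ := exists_log_T_le.{u} (tol := tol) hP Z hL hA (inv_pos.2 hP.ζ_mem.1)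
  refine ⟨K₁ * K₂ * A, fun R x z r h hz hr hr' => ?_⟩
  have hx := h.x_pos hL hA
  have hl : 0 < Real.log (2 + x) := Real.log_pos (by linarith)
  have hε := R.ε_mem.1
  have hLδ := R.log_pos
  have hμ := R.invTol_pos
  have hlog' := (hlog R x z h hz).1
  rw [inv_mul_eq_div] at hlog'
  have h1 : √(R.d : ℝ) * R.σg z * Real.log ((R.T z : ℝ) / P.ζ) ≤
      √(R.d : ℝ) * (K₁ * Real.log (2 + x) * (Real.log (1 / R.δ) / R.ε) * R.invTol) *
        (K₂ * Real.log (2 + x)) :=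
    (mul_le_mul_of_nonneg_left hlog'
      (mul_nonneg (Real.sqrt_nonneg _) (σg_nonneg hP R z))).trans
      (mul_le_mul_of_nonneg_right (mul_le_mul_of_nonneg_left (hσ R x z h hz)
        (Real.sqrt_nonneg _)) (by positivity))
  calc _ ≤ √(R.d : ℝ) * (K₁ * Real.log (2 + x) * (Real.log (1 / R.δ) / R.ε) * R.invTol) *
        (K₂ * Real.log (2 + x)) * R.invTol :=
        (mul_le_mul_of_nonneg_right h1 hr).trans
          (mul_le_mul_of_nonneg_left hr' (by positivity))
    _ = K₁ * K₂ * Real.log (2 + x) ^ 2 * R.rate := by rw [rate]; ring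
    _ ≤ K₁ * K₂ * Real.log (2 + x) ^ 2 * (A * x) :=
        mul_le_mul_of_nonneg_left h.rate_le (by positivity)
    _ = _ := by ring

/-- Serves both subsampling terms. A single logarithm occurs; it is raised to the second power only
to match the noise terms. -/
theorem exists_inv_s_mul_log_mul_le (hP : P.Valid) {tol L₀ A : ℝ} (Z : ℝ) (hL : 0 < L₀)
    (hA : 0 < A) : ∃ K : ℝ, ∀ (R : Run.{u} P) (x z r : ℝ), R.InRange tol L₀ A x → |z| ≤ Z →
      0 ≤ r → r ≤ R.invTol ^ 2 →
      R.s⁻¹ * (Real.log (2 * (R.d : ℝ) * (R.T z : ℝ) / P.η) + 1 / 4) * r ≤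
        K * (x * Real.log (2 + x) ^ 2) := by
  have hη := hP.η_mem.1
  have hs0 := hP.sMin_mem.1
  have hl2 : 0 < Real.log 2 := Real.log_pos (by norm_num)
  obtain ⟨K, hK, hlog⟩ := exists_log_T_le.{u} (tol := tol) hP Z hL hA (a := 2 / P.η)
    (by positivity)
  refine ⟨P.sMin⁻¹ * (K + 1 / 4 / Real.log 2) * (A / L₀) / Real.log 2,
    fun R x z r h hz hr hr' => ?_⟩
  have hx := h.x_pos hL hA
  have hl : Real.log 2 ≤ Real.log (2 + x) := Real.log_le_log (by norm_num) (by linarith)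
  set l := Real.log (2 + x) with hl_def
  have hl0 : 0 < l := hl2.trans_le hl
  have hs := R.s_pos
  have hlog' := (hlog R x z h hz).2
  have e : 2 / P.η * R.d * R.T z = 2 * (R.d : ℝ) * (R.T z : ℝ) / P.η := by ring
  rw [e] at hlog'
  have h1 : Real.log (2 * (R.d : ℝ) * (R.T z : ℝ) / P.η) + 1 / 4 ≤
      (K + 1 / 4 / Real.log 2) * l := by
    have : 1 / 4 ≤ 1 / 4 / Real.log 2 * l := by
      rw [div_mul_eq_mul_div, le_div_iff₀ hl2]
      linarith
    linarith
  have h2 : R.s⁻¹ ≤ P.sMin⁻¹ := inv_anti₀ hs0 R.sMin_le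
  have hll : l ≤ l ^ 2 / Real.log 2 := by
    rw [le_div_iff₀ hl2, sq]
    exact mul_le_mul_of_nonneg_left hl hl0.le
  calc _ ≤ P.sMin⁻¹ * ((K + 1 / 4 / Real.log 2) * l) * (A / L₀ * x) := by
        refine mul_le_mul ?_ (hr'.trans (h.invTol_sq_le hL)) hr (by positivity)
        exact (mul_le_mul_of_nonneg_left h1 (by positivity)).trans
          (mul_le_mul_of_nonneg_right h2 (by positivity))
    _ = P.sMin⁻¹ * (K + 1 / 4 / Real.log 2) * (A / L₀ * x) * l := by ring
    _ ≤ P.sMin⁻¹ * (K + 1 / 4 / Real.log 2) * (A / L₀ * x) * (l ^ 2 / Real.log 2) :=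
        mul_le_mul_of_nonneg_left hll (by positivity)
    _ = _ := by ring

theorem exists_nMin_le (hP : P.Valid) {tol L₀ A : ℝ} (Z : ℝ) (hL : 0 < L₀) (hA : 0 < A) :
    ∃ K : ℝ, 0 < K ∧ ∀ (R : Run.{u} P) (x z : ℝ), R.InRange tol L₀ A x → |z| ≤ Z →
      R.nMin z ≤ softBound K 2 x := by
  have hc := hP.c_pos
  have hc₁ := hP.c₁_pos
  have hc₂ := hP.c₂_pos
  have hM := hP.M_pos
  have hC := hP.C_pos
  obtain ⟨K₁, h₁⟩ := exists_sqrt_d_mul_σg_mul_log_mul_le.{u} (tol := tol) hP Z hL hA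
  obtain ⟨K₂, h₂⟩ := exists_inv_s_mul_log_mul_le.{u} (tol := tol) hP Z hL hA
  set q₁ := P.c₁⁻¹ + (P.c₂ / P.M)⁻¹ with hq₁
  have hq₁0 : 0 < q₁ := by positivity
  set q₃ := (P.c₁ ^ 2)⁻¹ + P.M ^ 2 / P.c₂ ^ 2 with hq₃
  have hq₃0 : 0 < q₃ := by positivity
  set N₁ := 2 * √2 * P.Bg * q₁ * K₁ with hN₁
  set N₂ := 2 * P.C * P.BH * P.c⁻¹ * tol * K₁ with hN₂
  set N₃ := 64 * P.Bg ^ 2 * q₃ * K₂ with hN₃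
  set N₄ := 32 * P.BH ^ 2 * (P.c ^ 2)⁻¹ * tol ^ 2 * K₂ with hN₄
  -- The 1 secures positivity: K₁ and K₂ have no known sign, and the bounds on the loss derivatives
  -- may be 0.
  refine ⟨max 1 (max (max N₁ N₂) (max N₃ N₄)), lt_max_of_lt_left one_pos, ?_⟩
  intro R x z h hz
  have hx := h.x_pos hL hA
  have hl : 0 < Real.log (2 + x) := Real.log_pos (by linarith)
  have hBg := R.Bg_nonneg
  have hBH := R.BH_nonneg
  have hs := R.s_pos
  have ha := R.εg_pos
  have hb := R.εH_pos
  have hμ := R.invTol_pos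
  have htol := h.tol_pos
  have hxl : 0 ≤ x * Real.log (2 + x) ^ 2 := by positivity
  have hsoft : ∀ N, N ≤ max 1 (max (max N₁ N₂) (max N₃ N₄)) →
      N * (x * Real.log (2 + x) ^ 2) ≤
        softBound (max 1 (max (max N₁ N₂) (max N₃ N₄))) 2 x := by
    intro N hN
    rw [softBound, mul_assoc]
    exact mul_le_mul_of_nonneg_right hN hxl
  refine max_le (max_le ?_ ?_) (max_le ?_ ?_)
  · refine le_trans ?_ (hsoft N₁ (by simp))
    have hr : (min (P.c₁ * R.εg) (P.c₂ / P.M * R.εH ^ 2))⁻¹ ≤ q₁ * R.invTol := by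
      refine (inv_min_le_add (by positivity) (by positivity)).trans ?_
      rw [mul_inv, mul_inv (P.c₂ / P.M), hq₁, add_mul]
      exact add_le_add (mul_le_mul_of_nonneg_left R.inv_εg_le (by positivity))
        (mul_le_mul_of_nonneg_left R.inv_sq_εH_le (by positivity))
    have hm : 0 < min (P.c₁ * R.εg) (P.c₂ / P.M * R.εH ^ 2) :=
      lt_min (by positivity) (by positivity)
    have := h₁ R x z (q₁⁻¹ * (min (P.c₁ * R.εg) (P.c₂ / P.M * R.εH ^ 2))⁻¹) h hz
      (by positivity) ((inv_mul_le_iff₀ hq₁0).2 hr)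
    calc _ = 2 * √2 * P.Bg * q₁ * (√(R.d : ℝ) * R.σg z * Real.log ((R.T z : ℝ) / P.ζ) *
          (q₁⁻¹ * (min (P.c₁ * R.εg) (P.c₂ / P.M * R.εH ^ 2))⁻¹)) := by
          rw [Real.sqrt_mul (by norm_num)]
          field_simp
      _ ≤ 2 * √2 * P.Bg * q₁ * (K₁ * (x * Real.log (2 + x) ^ 2)) :=
          mul_le_mul_of_nonneg_left this (by positivity)
      _ = _ := by rw [hN₁]; ring
  · refine le_trans ?_ (hsoft N₂ (by simp))
    have := h₁ R x z (tol⁻¹ * R.εH⁻¹) h hz (by positivity)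
      ((inv_mul_le_iff₀ htol).2 h.inv_εH_le)
    calc _ = 2 * P.C * P.BH * P.c⁻¹ * tol * (√(R.d : ℝ) * R.σg z *
          Real.log ((R.T z : ℝ) / P.ζ) * (tol⁻¹ * R.εH⁻¹)) := by
          rw [σH]
          field_simp
      _ ≤ 2 * P.C * P.BH * P.c⁻¹ * tol * (K₁ * (x * Real.log (2 + x) ^ 2)) :=
          mul_le_mul_of_nonneg_left this (by positivity)
      _ = _ := by rw [hN₂]; ring
  · refine le_trans ?_ (hsoft N₃ (by simp))
    set m := max ((P.c₁ ^ 2)⁻¹ * (R.εg ^ 2)⁻¹) (P.M ^ 2 / P.c₂ ^ 2 * (R.εH ^ 4)⁻¹) with hm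
    have hm0 : 0 ≤ m := le_max_of_le_left (by positivity)
    have hr : m ≤ q₃ * R.invTol ^ 2 :=
      max_le
        (mul_le_mul (le_add_of_nonneg_right (by positivity)) R.inv_sq_εg_le (by positivity)
          hq₃0.le)
        (mul_le_mul (le_add_of_nonneg_left (by positivity)) R.inv_pow_four_εH_le
          (by positivity) hq₃0.le)
    have := h₂ R x z (q₃⁻¹ * m) h hz (by positivity) ((inv_mul_le_iff₀ hq₃0).2 hr)
    calc _ = 64 * P.Bg ^ 2 * q₃ * (R.s⁻¹ *
          (Real.log (2 * (R.d : ℝ) * (R.T z : ℝ) / P.η) + 1 / 4) * (q₃⁻¹ * m)) := by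
          field_simp
      _ ≤ 64 * P.Bg ^ 2 * q₃ * (K₂ * (x * Real.log (2 + x) ^ 2)) :=
          mul_le_mul_of_nonneg_left this (by positivity)
      _ = _ := by rw [hN₃]; ring
  · refine le_trans ?_ (hsoft N₄ (by simp))
    have := h₂ R x z ((tol ^ 2)⁻¹ * (R.εH ^ 2)⁻¹) h hz (by positivity)
      ((inv_mul_le_iff₀ (by positivity)).2 h.inv_sq_εH_le_mul_sq)
    -- Adding 1/4 to the logarithm brings this term to the form covered by `h₂`.
    calc _ ≤ R.s⁻¹ * 32 * P.BH ^ 2 *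
          (Real.log (2 * (R.d : ℝ) * (R.T z : ℝ) / P.η) + 1 / 4) * (P.c ^ 2)⁻¹ *
            (R.εH ^ 2)⁻¹ := by
          gcongr
          linarith
      _ = 32 * P.BH ^ 2 * (P.c ^ 2)⁻¹ * tol ^ 2 * (R.s⁻¹ *
          (Real.log (2 * (R.d : ℝ) * (R.T z : ℝ) / P.η) + 1 / 4) *
            ((tol ^ 2)⁻¹ * (R.εH ^ 2)⁻¹)) := by
          field_simp
      _ ≤ 32 * P.BH ^ 2 * (P.c ^ 2)⁻¹ * tol ^ 2 * (K₂ * (x * Real.log (2 + x) ^ 2)) :=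
          mul_le_mul_of_nonneg_left this (by positivity)
      _ = _ := by rw [hN₄]; ring

/-! ### The random noise on the function value -/

/-- The standard deviation of the noise on the function value is of order `x / m`. -/
theorem exists_Δf_mul_σf_le (hP : P.Valid) {tol L₀ A : ℝ} (hL : 0 < L₀) :
    ∃ W : ℝ, ∀ (R : Run.{u} P) (x : ℝ), R.InRange tol L₀ A x →
      R.Δf * R.σf ≤ W * x / R.m := by
  have hcf := hP.cf_mem.1
  set Q := |Real.log (1.25 / P.cf)| / L₀ + 1 with hQ
  have hQ0 : 0 < Q := by positivity
  refine ⟨P.B * √(2 * Q / L₀) / P.cf * (A * tol ^ 2), fun R x h => ?_⟩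
  have hB := R.B_nonneg
  have hε := R.ε_mem.1
  have hLδ := R.log_pos
  have hm : (0 : ℝ) < R.m := Nat.cast_pos.2 R.m_pos
  have hlog := log_div_δ_le (a := 1.25 / P.cf) (by positivity) hL R h.le_log
  rw [div_div] at hlog
  have hsq : √(2 * Real.log (1.25 / R.δf)) ≤ √(2 * Q / L₀) * Real.log (1 / R.δ) := by
    rw [← Real.sqrt_sq hLδ.le, ← Real.sqrt_mul (by positivity)]
    refine Real.sqrt_le_sqrt ?_
    -- The root of log(1/δ) is traded for log(1/δ) itself, the factor present in the rate, at the
    -- cost of 1/√L₀.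
    have h1 : Real.log (1 / R.δ) ≤ Real.log (1 / R.δ) ^ 2 / L₀ := by
      rw [le_div_iff₀ hL, sq]
      exact mul_le_mul_of_nonneg_left h.le_log hLδ.le
    calc 2 * Real.log (1.25 / R.δf) ≤ 2 * (Q * Real.log (1 / R.δ)) :=
          mul_le_mul_of_nonneg_left hlog (by norm_num)
      _ ≤ 2 * (Q * (Real.log (1 / R.δ) ^ 2 / L₀)) := by gcongr
      _ = _ := by ring
  calc R.Δf * R.σf = P.B / P.cf / R.m / R.ε * √(2 * Real.log (1.25 / R.δf)) := by
        rw [Δf, σf, εf]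
        field_simp
    _ ≤ P.B / P.cf / R.m / R.ε * (√(2 * Q / L₀) * Real.log (1 / R.δ)) :=
        mul_le_mul_of_nonneg_left hsq (by positivity)
    _ = P.B * √(2 * Q / L₀) / P.cf / R.m * (Real.log (1 / R.δ) / R.ε) := by
        field_simp
    _ ≤ P.B * √(2 * Q / L₀) / P.cf / R.m * (A * tol ^ 2 * x) :=
        mul_le_mul_of_nonneg_left h.log_div_mul_le (by positivity)
    _ = _ := by ring

theorem Δf_mul_σf_nonneg (hP : P.Valid) (R : Run.{u} P) : 0 ≤ R.Δf * R.σf :=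
  mul_nonneg (div_nonneg R.B_nonneg (Nat.cast_nonneg _))
    (div_nonneg (Real.sqrt_nonneg _) (mul_nonneg hP.cf_mem.1.le R.ε_mem.1.le))

/-- Chebyshev's inequality for a centred Gaussian law of variance at most one. -/
theorem one_sub_le_gaussianReal_abs_le {v : NNReal} (hv : v ≤ 1) {β : ℝ} (hβ : 0 < β) :
    1 - β ≤ (ProbabilityTheory.gaussianReal 0 v).real {z : ℝ | |z| ≤ 1 / √β} := by
  set μ := ProbabilityTheory.gaussianReal 0 v with hμ
  have hr : 0 < 1 / √β := by positivity
  have hmem : MeasureTheory.MemLp id 2 μ := ProbabilityTheory.memLp_id_gaussianReal 2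
  have h := ProbabilityTheory.meas_ge_le_variance_div_sq hmem hr
  simp only [id_eq] at h
  rw [hμ, ProbabilityTheory.integral_id_gaussianReal, ProbabilityTheory.variance_id_gaussianReal,
    ← hμ] at h
  have h' : μ.real {z : ℝ | 1 / √β ≤ |z|} ≤ β := by
    refine ENNReal.toReal_le_of_le_ofReal hβ.le ?_
    simp only [sub_zero] at h
    refine h.trans (ENNReal.ofReal_le_ofReal ?_)
    rw [div_pow, one_pow, Real.sq_sqrt hβ.le, div_div_eq_mul_div, div_one]
    exact mul_le_of_le_one_left hβ.le (by exact_mod_cast hv)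
  have hcompl := MeasureTheory.probReal_compl_eq_one_sub (μ := μ)
    (measurableSet_le measurable_const measurable_id.abs : MeasurableSet {z : ℝ | 1 / √β ≤ |z|})
  have hsub : {z : ℝ | 1 / √β ≤ |z|}ᶜ ⊆ {z : ℝ | |z| ≤ 1 / √β} :=
    fun z hz => (le_total |z| (1 / √β)).resolve_right hz
  have := MeasureTheory.measureReal_mono (μ := μ) hsub
  linarith

end Run

/-! ### From bounded noise to the two-part asymptotic statement -/

theorem softBound_mono {K K' x : ℝ} (k : ℕ) (hx : 0 ≤ x) (h : K ≤ K') :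
    softBound K k x ≤ softBound K' k x :=
  mul_le_mul_of_nonneg_right (mul_le_mul_of_nonneg_right h hx)
    (pow_nonneg (Real.log_nonneg (by linarith)) k)

theorem nMinIsSoftO_of_inRange {P : Consts} (hP : P.Valid) {tol L₀ A : ℝ} (hL : 0 < L₀)
    (hA : 0 < A) {S : Set (Run.{u} P)} {g : Run.{u} P → ℝ}
    (h : ∀ R ∈ S, R.InRange tol L₀ A (g R)) : NMinIsSoftO S g := by
  refine ⟨fun Z => ?_, fun β hβ => ?_⟩
  · obtain ⟨K, hK, hn⟩ := Run.exists_nMin_le.{u} (tol := tol) hP Z hL hA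
    exact ⟨K, hK, 2, fun R hR z hz => hn R _ z (h R hR) hz⟩
  · obtain ⟨K, hK, hn⟩ := Run.exists_nMin_le.{u} (tol := tol) hP (1 / √β) hL hA
    obtain ⟨W, hW⟩ := Run.exists_Δf_mul_σf_le.{u} (P := P) (tol := tol) (A := A) hP hL
    have hs0 := hP.sMin_mem.1
    have hl2 : 0 < Real.log 2 := Real.log_pos (by norm_num)
    -- The second entry gives W·x ≤ sMin·K'·x·(log 2)² ≤ sMin·n ≤ m, hence standard deviation at
    -- most 1.
    set K' := max K (W / (P.sMin * Real.log 2 ^ 2)) with hK'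
    refine ⟨K', lt_max_of_lt_left hK, 2, fun R hR hsize => ?_⟩
    have hx := (h R hR).x_pos hL hA
    have hl : Real.log 2 ≤ Real.log (2 + g R) := Real.log_le_log (by norm_num) (by linarith)
    have hnpos : (0 : ℝ) < R.n := Nat.cast_pos.2 R.n_pos
    have hmpos : (0 : ℝ) < R.m := Nat.cast_pos.2 R.m_pos
    have hm : P.sMin * R.n ≤ R.m := (le_div_iff₀ hnpos).1 R.sMin_le
    have hK'0 : 0 < K' := lt_max_of_lt_left hK
    have hstd : R.Δf * R.σf ≤ 1 := by
      refine (hW R _ (h R hR)).trans ?_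
      rw [div_le_one hmpos]
      calc W * g R ≤ K' * (P.sMin * Real.log 2 ^ 2) * g R :=
            mul_le_mul_of_nonneg_right
              ((div_le_iff₀ (by positivity)).1 (le_max_right _ _)) hx.le
        _ = P.sMin * (K' * g R * Real.log 2 ^ 2) := by ring
        _ ≤ P.sMin * softBound K' 2 (g R) := by
            rw [softBound]
            gcongr
        _ ≤ P.sMin * R.n := mul_le_mul_of_nonneg_left hsize hs0.le
        _ ≤ R.m := hm
    have hvar : Real.toNNReal (R.Δf ^ 2 * R.σf ^ 2) ≤ 1 := by
      rw [Real.toNNReal_le_one, ← mul_pow]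
      exact pow_le_one₀ (Run.Δf_mul_σf_nonneg hP R) hstd
    refine (Run.one_sub_le_gaussianReal_abs_le hvar hβ.1).trans ?_
    have : MeasureTheory.IsProbabilityMeasure R.lawZ :=
      ProbabilityTheory.instIsProbabilityMeasureGaussianReal _ _
    exact MeasureTheory.measureReal_mono (μ := R.lawZ) fun z hz =>
      (hn R _ z (h R hR) hz).trans (softBound_mono 2 hx.le (le_max_left _ _))

namespace Run

variable {P : Consts}

/-- With εH² = M·εg both entries of μ are multiples of 1/εg, so μ ≤ max(1, 1/M)/εg; squaring gives
the constant A. -/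
theorem inRange_of_εH_eq {tol L₀ : ℝ} (hP : P.Valid) (R : Run.{u} P)
    (hH : R.εH = √(P.M * R.εg)) (hg : R.εg ≤ tol) (hL : L₀ ≤ Real.log (1 / R.δ)) :
    R.InRange (max tol √(P.M * tol)) L₀ (max 1 P.M⁻¹ ^ 2)
      (√(R.d : ℝ) * Real.log (1 / R.δ) / (R.ε * R.εg ^ 2)) := by
  have hM := hP.M_pos
  have ha := R.εg_pos
  have hε := R.ε_mem.1
  have hLδ := R.log_pos
  refine ⟨hg.trans (le_max_left _ _), ?_, hL, ?_⟩
  · rw [hH]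
    exact (Real.sqrt_le_sqrt (mul_le_mul_of_nonneg_left hg hM.le)).trans (le_max_right _ _)
  · have hμ : R.invTol ≤ max 1 P.M⁻¹ * R.εg⁻¹ := by
      refine max_le (le_mul_of_one_le_left (by positivity) (le_max_left _ _)) ?_
      rw [hH, Real.sq_sqrt (by positivity), mul_inv]
      exact mul_le_mul_of_nonneg_right (le_max_right _ _) (by positivity)
    calc R.rate ≤ √(R.d : ℝ) * Real.log (1 / R.δ) / R.ε * (max 1 P.M⁻¹ * R.εg⁻¹) ^ 2 :=
          mul_le_mul_of_nonneg_left (pow_le_pow_left₀ R.invTol_pos.le hμ 2) (by positivity)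
      _ = _ := by field_simp

end Run

end DPMiniBatch

open DPMiniBatch in
theorem mainTheorem11 (P : Consts) (hP : P.Valid) (tolMax δMax : ℝ) (hδMax : δMax < 1) :
    NMinIsSoftO {R : Run.{u} P | R.εg ≤ tolMax ∧ R.εH ≤ tolMax ∧ R.δ ≤ δMax}
      (fun R => √(R.d : ℝ) * Real.log (1 / R.δ) / R.ε *
        max (max (R.εg ^ 2)⁻¹ (R.εg⁻¹ * (R.εH ^ 2)⁻¹)) (R.εH ^ 4)⁻¹) ∧
    NMinIsSoftO {R : Run.{u} P | R.εH = √(P.M * R.εg) ∧ R.εg ≤ tolMax ∧ R.δ ≤ δMax}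
      (fun R => √(R.d : ℝ) * Real.log (1 / R.δ) / (R.ε * R.εg ^ 2)) ∧
    NMinIsSoftO {R : Run.{u} P | R.εH = √(P.M * R.εg) ∧ R.εg ≤ tolMax ∧ R.δ ≤ δMax}
      (fun R => (R.d : ℝ) * Real.log (1 / R.δ) / (R.ε * R.εg ^ 2)) := by
  -- δMax may be nonpositive; the maximum with 1/2 lies in (0,1), so log(1/δ₁) is a positive lower
  -- bound.
  set δ₁ := max δMax (1 / 2) with hδ₁
  have hδ₁_pos : 0 < δ₁ := lt_max_of_lt_right (by norm_num)
  have hδ₁_lt : δ₁ < 1 := max_lt hδMax (by norm_num)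
  have hL : 0 < Real.log (1 / δ₁) := Real.log_pos ((one_lt_div hδ₁_pos).2 hδ₁_lt)
  have hlog : ∀ R : Run.{u} P, R.δ ≤ δMax → Real.log (1 / δ₁) ≤ Real.log (1 / R.δ) :=
    fun R hR => Real.log_le_log (by positivity)
      (one_div_le_one_div_of_le R.δ_mem.1 (hR.trans (le_max_left _ _)))
  have hA : 0 < max 1 P.M⁻¹ ^ 2 := pow_pos (lt_max_of_lt_left one_pos) 2
  refine ⟨nMinIsSoftO_of_inRange hP (tol := tolMax) hL one_pos ?_,
    nMinIsSoftO_of_inRange hP hL hA fun R hR =>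
      R.inRange_of_εH_eq hP hR.1 hR.2.1 (hlog R hR.2.2),
    nMinIsSoftO_of_inRange hP (tol := max tolMax √(P.M * tolMax)) hL hA ?_⟩
  · rintro R ⟨hg, hH, hδ⟩
    refine ⟨hg, hH, hlog R hδ, ?_⟩
    rw [one_mul, Run.rate, R.invTol_sq]
  · rintro R ⟨hH, hg, hδ⟩
    have h := R.inRange_of_εH_eq hP hH hg (hlog R hδ)
    refine ⟨h.εg_le, h.εH_le, h.le_log, h.rate_le.trans ?_⟩
    have hε := R.ε_mem.1
    have ha := R.εg_pos
    -- The third rate dominates the second because d ≥ 1.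
    have hd : √(R.d : ℝ) ≤ R.d :=
      (Real.sqrt_le_left (Nat.cast_nonneg _)).2
        (le_self_pow₀ (Nat.one_le_cast.2 R.d_pos) (by norm_num))
    have hLδ := R.log_pos
    gcongr
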